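/- Let $X$ and $Y$ be sets and let $a$ be a partial map from $Y$ to $X$. Maps are written on the right and composed from left to right. Let $\mathcal{PT}_{XY}^a$ be the sandwich semigroup of all partial maps from $X$ to $Y$, with product $f\star_a g = fag$. Let $P^a=\operatorname{Reg}(\mathcal{PT}_{XY}^a)$ be its set of regular elements, and let $\mathbb E_a(\mathcal{PT}_{XY}^a)$ be its subsemigroup generated by all its idempotents. Let $A=\operatorname{im}(a)$, $\alpha=|A|$, $\beta=|X\setminus A|$, and let $\Lambda_I=\prod_{x\in A}|xa^{-1}|$ be the product of the cardinalities of the $\ker(a)$-classes. Let $b$ be any partial map from $X$ to $Y$ with domain $A$ such that $(xb)a=x$ for all $x\in A$. Let $\mathcal{PT}_A$ be the semigroup of all partial transformations of $A$, let $\mathbb E(\mathcal{PT}_A)$ be its idempotent-generated subsemigroup, and let $\varphi:P^a\to\mathcal{PT}_A$ be the map $f\mapsto bafa$ (both the domain and the image of $bafa$ are contained in $A$). The rank of a semigroup is the least cardinality of a generating set, and the idempotent rank of an idempotent-generated semigroup is the least cardinality of a generating set consisting of idempotents. Then: 1. $\mathbb E_a(\mathcal{PT}_{XY}^a)=\mathbb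 E(\mathcal{PT}_A)\varphi^{-1}$. 2. If $P^a$ is infinite, then $$\operatorname{rank}(\mathbb E_a(\mathcal{PT}_{XY}^a))=\operatorname{idrank}(\mathbb E_a(\mathcal{PT}_{XY}^a))=|\mathbb E_a(\mathcal{PT}_{XY}^a)|=|P^a|.$$ 3. If $P^a$ is finite, then $\alpha$ is finite and $$\operatorname{rank}(\mathbb E_a(\mathcal{PT}_{XY}^a))=\binom{\alpha+1}{2}+\max\big((\alpha+1)^\beta,\Lambda_I\big);$$ if moreover $\alpha\neq 2$, then also $\operatorname{idrank}(\mathbb E_a(\mathcal{PT}_{XY}^a))=\operatorname{rank}(\mathbb E_a(\mathcal{PT}_{XY}^a))$. -/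

import Mathlib

universe u v

open Cardinal

namespace SandwichPT

section Semigroups

variable (S : Type u) [Semigroup S]

/-- The set `Reg(S)` of (von Neumann) regular elements of a semigroup. -/
def regularElements : Set S := {x | ∃ y : S, x = x * y * x}

/-- The idempotent-generated subsemigroup `𝔼(S) = ⟨E(S)⟩` of a semigroup. -/
def idempotentGenerated : Subsemigroup S :=
  Subsemigroup.closure {e : S | IsIdempotentElem e}

/-- The rank of a semigroup: the least cardinality of a generating set (generation is by
non-empty products). -/
noncomputable def semigroupRank : Cardinal.{u} :=
  sInf {c : Cardinal.{u} | ∃ s : Set S, Subsemigroup.closure s = ⊤ ∧ #s = c}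

/-- The idempotent rank of an idempotent-generated semigroup: the least cardinality of a
generating set consisting of idempotents. -/
noncomputable def idempotentRank : Cardinal.{u} :=
  sInf {c : Cardinal.{u} | ∃ s : Set S,
    (∀ e ∈ s, IsIdempotentElem e) ∧ Subsemigroup.closure s = ⊤ ∧ #s = c}

end Semigroups

section Transformations

/-- Composition of partial maps from left to right: `f` is performed first. -/
def comp {A : Type*} {B : Type*} {C : Type*} (f : A →. B) (g : B →. C) : A →. C :=
  PFun.comp g f

/-- The partial transformation semigroup on `A`. -/
def PT (A : Type u) : Type u := A →. A

instance (A : Type u) : Semigroup (PT A) where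
  mul f g := comp f g
  mul_assoc f g h := (PFun.comp_assoc h g f).symm

/-- The underlying set of the sandwich semigroup on the partial maps from `X` to `Y` with
sandwich element `a`. -/
def Sandwich {X : Type u} {Y : Type v} (_a : Y →. X) : Type (max u v) := X →. Y

theorem sandwich_assoc {X : Type u} {Y : Type v} (a : Y →. X) (f g h : X →. Y) :
    comp (comp (comp (comp f a) g) a) h = comp (comp f a) (comp (comp g a) h) := by
  simp only [comp, PFun.comp_assoc]

/-- The sandwich product `f ⋆ g = f a g`. -/
instance {X : Type u} {Y : Type v} (a : Y →. X) : Semigroup (Sandwich a) where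
  mul f g := comp (comp f a) g
  mul_assoc f g h := sandwich_assoc a f g h

variable {X : Type u} {Y : Type v}

/-- `b` has domain `im(a)` and sends each `x ∈ im(a)` to some `y` with `y a = x`. -/
def IsSection (a : Y →. X) (b : X →. Y) : Prop :=
  b.Dom = a.ran ∧ ∀ x y, y ∈ b x → x ∈ a y

/-- The part of a partial transformation of `X` that lies in `A × A`, as a partial
transformation of `A`. -/
def restrictTo (A : Set X) (g : X →. X) : PT A :=
  fun x => (g x).bind fun y => Part.assert (y ∈ A) fun h => Part.some ⟨y, h⟩

/-- The map `φ : f ↦ b a f a` from the regular elements of the sandwich semigroup to the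
partial transformations of `im(a)`; domain and image of `b a f a` lie in `im(a)`. -/
def phi (a : Y →. X) (b : X →. Y) (f : regularElements (Sandwich a)) : PT a.ran :=
  restrictTo a.ran (comp (comp (comp b a) (f : Sandwich a)) a)

/-- The product `Λ` of the cardinalities of the `ker(a)`-classes, which are the sets
`{y | y a = x}` for `x ∈ im(a)`. -/
noncomputable def kernelProd (a : Y →. X) : Cardinal.{max u v} :=
  Cardinal.prod fun x : a.ran => #{y : Y | (x : X) ∈ a y}

end Transformations

end SandwichPT

/-!
Write `A = im(a)`. The proof rests on coordinates for the regular elements of the sandwich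
semigroup. A map of `X \ A` partially into `A` is the same thing as a partial retraction `r` of `X`
onto `A` (`Retr`), and `a` has total sections `s : A → Y` (`Sect`). The element `theta r g s`
retracts by `r`, applies `g : PT A`, and lifts by `s`. Since `s` followed by `a` and `r` is the
identity of `A`, one has `theta r g s * theta r' g' s' = theta r (g * g') s'` (`theta_mul`), and the
regular elements are exactly the `theta r g s` (`mem_regularElements_iff`). So they form a quotient
of the product of a rectangular band with `PT A`. The coordinate `g` is the value of `phi`
(`phi_theta`), and over `g = 1` the coordinates `r` and `s` are unique as well (`theta_id_inj`).
Hence `theta r g s` is idempotent exactly if `g` is, and a product of idempotents exactly if `g` is.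

For the lower bound on the rank: a product of idempotents of `PT A` that is total and injective is
the identity (`PT.eq_id_of_injective`). So every generating set must contain, over the identity,
every `r` and every `s` as a coordinate, which costs `max #Retr #Sect` elements, the cardinal
`max ((α + 1) ^ β) Λ`. Away from the identity, the first factor of a product that is not over the
identity has a kernel no larger than the product. Viewing partial maps as maps of `Part A` that fix
`none`, each of the `(α + 1).choose 2` pairs of points of `Part A` is the only pair identified by
some idempotent, and therefore by some generator.

For the upper bound, every idempotent of `PT A` other than `1` is a product of idempotents moving
one point (`PT.mem_of_isIdempotentElem`). One such idempotent for each pair suffices if `α ≠ 2`,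
with the pairs in `A` oriented as a suitable tournament, because twice around a 3-cycle reverses an
arrow (`PT.single_triangle`); for `α = 2` there are three generators that are not idempotent. These
are lifted arbitrarily and supplemented by elements over the identity whose coordinates exhaust
`Retr` and `Sect`.

In the infinite case, the number of regular elements is at most `#Retr * #(PT A) * #Sect`. If `A` is
finite, this is at most `max #Retr #Sect`, and so at most the rank; if `A` is infinite, the
semigroup is uncountable and no smaller than `PT A`, as it contains all partial identities of `A`.
-/

namespace SandwichPT

/-! ### Partial transformations -/

section PartialTransformations

variable {A : Type u}

/-- A partial transformation as a total self-map of `Part A` that fixes `Part.none`. -/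
def PT.ap (g : PT A) (p : Part A) : Part A := p.bind g

theorem PT.ap_mul (f g : PT A) (p : Part A) : (f * g).ap p = g.ap (f.ap p) :=
  (Part.bind_assoc p f g).symm

theorem PT.ap_none (g : PT A) : g.ap Part.none = Part.none := Part.bind_none g

theorem PT.ap_some (g : PT A) (x : A) : g.ap (Part.some x) = g x := Part.bind_some x g

theorem PT.ext_ap {f g : PT A} (h : ∀ p, f.ap p = g.ap p) : f = g :=
  funext fun x => (PT.ap_some f x).symm.trans ((h _).trans (PT.ap_some g x))

/-- The identity of the partial transformation semigroup, which is only equipped with the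
structure of a semigroup. -/
def PT.id : PT A := fun x => Part.some x

theorem PT.ap_id (p : Part A) : (PT.id : PT A).ap p = p := Part.bind_some_right p

theorem PT.id_mul (f : PT A) : PT.id * f = f :=
  PT.ext_ap fun p => by rw [PT.ap_mul, PT.ap_id]

theorem PT.mul_id (f : PT A) : f * PT.id = f :=
  PT.ext_ap fun p => by rw [PT.ap_mul, PT.ap_id]

theorem PT.isIdempotentElem_id : IsIdempotentElem (PT.id : PT A) := PT.id_mul _

/-- Every partial transformation is von Neumann regular: a section of `g` on its image, undefined
elsewhere, is an inner inverse. -/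
theorem PT.exists_inner_inverse (g : PT A) : ∃ h : PT A, g * h * g = g := by
  classical
  have key (g : A → Part A) : ∃ h : A → Part A, ∀ x, ((g x).bind h).bind g = g x := by
    let h : A → Part A := fun y =>
      if hy : ∃ x, y ∈ g x then Part.some hy.choose else Part.none
    refine ⟨h, fun x => ?_⟩
    rcases Part.eq_none_or_eq_some (g x) with hx | ⟨y, hx⟩
    · rw [hx, Part.bind_none, Part.bind_none]
    · have hy : ∃ x, y ∈ g x := ⟨x, hx ▸ Part.mem_some y⟩
      rw [hx, Part.bind_some, show h y = Part.some hy.choose from dif_pos hy, Part.bind_some]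
      exact Part.eq_some_iff.2 hy.choose_spec
  obtain ⟨h, hh⟩ := key g
  exact ⟨h, funext hh⟩

/-- A partial transformation `g` is injective as a self-map of `Part A` (so: total and injective)
and a product of idempotents only if it is the identity. -/
theorem PT.eq_id_of_injective {g : PT A} (hg : g ∈ idempotentGenerated (PT A))
    (hinj : Function.Injective g.ap) : g = PT.id := by
  induction hg using Subsemigroup.closure_induction with
  | mem e he =>
    refine PT.ext_ap fun p => hinj ?_
    rw [← PT.ap_mul, show e * e = e from he, PT.ap_id]
  | mul f g _ _ hf hg =>
    obtain rfl : f = PT.id := hf fun p q hpq => hinj <| by rw [PT.ap_mul, PT.ap_mul, hpq]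
    rw [PT.id_mul] at hinj ⊢
    exact hg hinj

theorem PT.eq_id_of_mul_eq_id {f g : PT A} (hf : f ∈ idempotentGenerated (PT A))
    (h : f * g = PT.id) : f = PT.id ∧ g = PT.id := by
  obtain rfl : f = PT.id := PT.eq_id_of_injective hf fun p q hpq => by
    rw [← PT.ap_id p, ← PT.ap_id q, ← h, PT.ap_mul, PT.ap_mul, hpq]
  exact ⟨rfl, by rwa [PT.id_mul] at h⟩

end PartialTransformations

/-! ### Coordinates on the regular elements -/

section Coordinates

variable {X : Type u} {Y : Type v} (a : Y →. X)

/-- The ways of mapping the points outside `im(a)` partially into `im(a)`; each extends by the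
identity to a partial retraction of `X` onto `im(a)`. -/
abbrev Retr : Type u := ↥(a.ranᶜ : Set X) → Part a.ran

/-- The total sections of `a` over its image. -/
abbrev Sect : Type max u v := ∀ x : a.ran, {y : Y | (x : X) ∈ a y}

variable {a}

open Classical in
/-- The partial retraction of `X` onto `im(a)` determined by its values outside `im(a)`. -/
noncomputable def Retr.extend (r : Retr a) (x : X) : Part a.ran :=
  if h : x ∈ a.ran then Part.some ⟨x, h⟩ else r ⟨x, h⟩

theorem Retr.extend_of_mem (r : Retr a) (x : a.ran) : r.extend x = Part.some x := by
  simp [Retr.extend]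

theorem Retr.extend_of_notMem (r : Retr a) (x : ↥(a.ranᶜ : Set X)) : r.extend x = r x := by
  have : (x : X) ∉ a.ran := x.2
  simp [Retr.extend, this]

/-- The element of the sandwich semigroup that retracts `X` onto `im(a)` by `r`, applies `g`, and
lifts the result to `Y` by the section `s`. -/
noncomputable def theta (r : Retr a) (g : PT a.ran) (s : Sect a) : Sandwich a :=
  fun x => ((r.extend x).bind g).map fun z => (s z : Y)

theorem mem_theta {r : Retr a} {g : PT a.ran} {s : Sect a} {x : X} {y : Y} :
    y ∈ theta r g s x ↔ ∃ z ∈ r.extend x, ∃ w ∈ g z, (s w : Y) = y := by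
  refine (Part.mem_map_iff _).trans ?_
  constructor
  · rintro ⟨w, hw, h⟩
    obtain ⟨z, hz, hw⟩ := Part.mem_bind_iff.1 hw
    exact ⟨z, hz, w, hw, h⟩
  · rintro ⟨z, hz, w, hw, h⟩
    exact ⟨w, Part.mem_bind hz hw, h⟩

theorem mem_theta_of_mem {r : Retr a} {g : PT a.ran} {s : Sect a} {x : a.ran} {y : Y} :
    y ∈ theta r g s x ↔ ∃ w ∈ g x, (s w : Y) = y := by
  rw [mem_theta, Retr.extend_of_mem]
  simp

theorem mem_mul {f g : Sandwich a} {x : X} {y : Y} :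
    y ∈ (f * g) x ↔ ∃ z ∈ f x, ∃ w ∈ a z, y ∈ g w := by
  refine Part.mem_bind_iff.trans ?_
  constructor
  · rintro ⟨w, hw, h⟩
    obtain ⟨z, hz, hw⟩ := Part.mem_bind_iff.1 hw
    exact ⟨z, hz, w, hw, h⟩
  · rintro ⟨z, hz, w, hw, h⟩
    exact ⟨w, Part.mem_bind hz hw, h⟩

theorem Sandwich.ext_mem {f g : Sandwich a} (h : ∀ x y, y ∈ f x ↔ y ∈ g x) : f = g :=
  PFun.ext h

/-- The coordinates multiply as in the direct product of a rectangular band with the partial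
transformation semigroup of `im(a)`, since a section followed by `a` and a retraction is the
identity. -/
theorem theta_mul (r r' : Retr a) (g g' : PT a.ran) (s s' : Sect a) :
    theta r g s * theta r' g' s' = theta r (g * g') s' := by
  refine Sandwich.ext_mem fun x y => ?_
  rw [mem_mul, mem_theta]
  constructor
  · rintro ⟨z, hz, w, hw, hy⟩
    obtain ⟨p, hp, q, hq, rfl⟩ := mem_theta.1 hz
    obtain rfl : (q : X) = w := Part.mem_unique (s q).2 hw
    obtain ⟨t, ht, rfl⟩ := mem_theta_of_mem.1 hy
    exact ⟨p, hp, t, Part.mem_bind hq ht, rfl⟩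
  · rintro ⟨p, hp, t, ht, rfl⟩
    obtain ⟨q, hq, ht⟩ := Part.mem_bind_iff.1 ht
    exact ⟨s q, mem_theta.2 ⟨p, hp, q, hq, rfl⟩, q, (s q).2, mem_theta_of_mem.2 ⟨t, ht, rfl⟩⟩

theorem Sect.injective (s s' : Sect a) {x x' : a.ran} (h : (s x : Y) = s' x') : x = x' := by
  have h1 : (x : X) ∈ a (s x) := (s x).2
  rw [h] at h1
  exact Subtype.ext (Part.mem_unique h1 (s' x').2)

theorem le_of_theta_eq {r r' : Retr a} {g g' : PT a.ran} {s s' : Sect a}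
    (h : theta r g s = theta r' g' s') {x y : a.ran} (hy : y ∈ g x) : y ∈ g' x := by
  have h1 : (s y : Y) ∈ theta r g s x := mem_theta_of_mem.2 ⟨y, hy, rfl⟩
  rw [h] at h1
  obtain ⟨w, hw, hws⟩ := mem_theta_of_mem.1 h1
  rwa [Sect.injective s s' hws.symm]

theorem theta_middle_inj {r r' : Retr a} {g g' : PT a.ran} {s s' : Sect a}
    (h : theta r g s = theta r' g' s') : g = g' :=
  PFun.ext fun _ _ => ⟨le_of_theta_eq h, le_of_theta_eq h.symm⟩

theorem le_of_theta_id_eq {r r' : Retr a} {s s' : Sect a}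
    (h : theta r PT.id s = theta r' PT.id s') {x : ↥(a.ranᶜ : Set X)} {y : a.ran} (hy : y ∈ r x) :
    y ∈ r' x := by
  rw [← Retr.extend_of_notMem r x] at hy
  rw [← Retr.extend_of_notMem r' x]
  have h1 : (s y : Y) ∈ theta r PT.id s x := mem_theta.2 ⟨y, hy, y, Part.mem_some _, rfl⟩
  rw [h] at h1
  obtain ⟨z, hz, w, hw, hws⟩ := mem_theta.1 h1
  obtain rfl : w = z := Part.mem_some_iff.1 hw
  rwa [Sect.injective s s' hws.symm]

theorem theta_id_inj {r r' : Retr a} {s s' : Sect a}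
    (h : theta r PT.id s = theta r' PT.id s') : r = r' ∧ s = s' := by
  refine ⟨PFun.ext fun _ _ => ⟨le_of_theta_id_eq h, le_of_theta_id_eq h.symm⟩, ?_⟩
  funext x
  have h1 : (s x : Y) ∈ theta r PT.id s x := mem_theta_of_mem.2 ⟨x, Part.mem_some _, rfl⟩
  rw [h] at h1
  obtain ⟨w, hw, hws⟩ := mem_theta_of_mem.1 h1
  obtain rfl : w = x := Part.mem_some_iff.1 hw
  exact Subtype.ext hws.symm

theorem isIdempotentElem_theta {r : Retr a} {g : PT a.ran} {s : Sect a} :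
    IsIdempotentElem (theta r g s) ↔ IsIdempotentElem g := by
  unfold IsIdempotentElem
  rw [theta_mul]
  exact ⟨theta_middle_inj, fun h => by rw [h]⟩

theorem Sect.nonempty (a : Y →. X) : Nonempty (Sect a) :=
  ⟨fun x => ⟨x.2.choose, x.2.choose_spec⟩⟩

theorem theta_mem_regularElements (r : Retr a) (g : PT a.ran) (s : Sect a) :
    theta r g s ∈ regularElements (Sandwich a) := by
  obtain ⟨h, hh⟩ := PT.exists_inner_inverse g
  exact ⟨theta r h s, by rw [theta_mul, theta_mul, hh]⟩

/-- The regular elements are exactly those that have coordinates. -/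
theorem mem_regularElements_iff {f : Sandwich a} :
    f ∈ regularElements (Sandwich a) ↔ ∃ r g s, f = theta r g s := by
  classical
  refine ⟨?_, fun ⟨r, g, s, h⟩ => h ▸ theta_mem_regularElements r g s⟩
  rintro ⟨e, he⟩
  have hmem : ∀ x y, y ∈ f x ↔
      ∃ z ∈ f x, ∃ w ∈ a z, ∃ z' ∈ e w, ∃ w' ∈ a z', y ∈ f w' := by
    intro x y
    conv_lhs => rw [he]
    rw [mem_mul]
    constructor
    · rintro ⟨z', hz', w', hw', hy⟩
      obtain ⟨z, hz, w, hw, hz'⟩ := mem_mul.1 hz'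
      exact ⟨z, hz, w, hw, z', hz', w', hw', hy⟩
    · rintro ⟨z, hz, w, hw, z', hz', w', hw', hy⟩
      exact ⟨z', mem_mul.2 ⟨z, hz, w, hw, hz'⟩, w', hw', hy⟩
  let toRan (p : Part X) : Part a.ran :=
    p.bind fun x => Part.assert (x ∈ a.ran) fun h => Part.some ⟨x, h⟩
  have mem_toRan : ∀ p (x : a.ran), x ∈ toRan p ↔ (x : X) ∈ p := by
    intro p x
    simp only [toRan, Part.mem_bind_iff, Part.mem_assert_iff, Part.mem_some_iff]
    constructor
    · rintro ⟨w, hw, _, rfl⟩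
      exact hw
    · intro h
      exact ⟨x, h, x.2, rfl⟩
  -- With `f = f a e a f`, retract by `f a e a` outside `im(a)`, and lift by `e a f` where possible.
  let r : Retr a := fun x => toRan ((((f x).bind a).bind e).bind a)
  let g : PT a.ran := fun x => toRan ((f x).bind a)
  let s : Sect a := fun x =>
    if h : ∃ y, (x : X) ∈ a y ∧ ∃ z ∈ e x, ∃ w ∈ a z, y ∈ f w then ⟨h.choose, h.choose_spec.1⟩
    else ⟨x.2.choose, x.2.choose_spec⟩
  have hs : ∀ x : a.ran, ∀ y, (x : X) ∈ a y → ∀ z ∈ e x, ∀ w ∈ a z, y ∈ f w → (s x : Y) = y := by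
    intro x y h1 z hz w hw hy
    have h : ∃ y, (x : X) ∈ a y ∧ ∃ z ∈ e x, ∃ w ∈ a z, y ∈ f w := ⟨y, h1, z, hz, w, hw, hy⟩
    have h2 : (s x : Y) = h.choose := by simp only [s, dif_pos h]
    obtain ⟨-, z', hz', w', hw', hy'⟩ := h.choose_spec
    obtain rfl := Part.mem_unique hz hz'
    obtain rfl := Part.mem_unique hw hw'
    exact h2.trans (Part.mem_unique hy' hy)
  have mem_g : ∀ (x w : a.ran), w ∈ g x ↔ ∃ y ∈ f x, (w : X) ∈ a y := by
    intro x w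
    exact (mem_toRan _ _).trans Part.mem_bind_iff
  have mem_r : ∀ x (w : a.ran), w ∈ r x ↔
      ∃ z ∈ f x, ∃ w' ∈ a z, ∃ z' ∈ e w', (w : X) ∈ a z' := by
    intro x w
    refine (mem_toRan _ _).trans ?_
    constructor
    · intro h
      obtain ⟨z', h, h1⟩ := Part.mem_bind_iff.1 h
      obtain ⟨w', h, h2⟩ := Part.mem_bind_iff.1 h
      obtain ⟨z, h, h3⟩ := Part.mem_bind_iff.1 h
      exact ⟨z, h, w', h3, z', h2, h1⟩
    · rintro ⟨z, h, w', h3, z', h2, h1⟩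
      exact Part.mem_bind (Part.mem_bind (Part.mem_bind h h3) h2) h1
  have key : ∀ (x : a.ran) y, y ∈ f x ↔ ∃ w ∈ g x, (s w : Y) = y := by
    intro x y
    have fwd : ∀ y, y ∈ f x → ∃ w ∈ g x, (s w : Y) = y := by
      intro y hy
      obtain ⟨z, hz, w, hw, z', hz', w', hw', hy'⟩ := (hmem _ _).1 hy
      obtain rfl := Part.mem_unique hz hy
      exact ⟨⟨w, z, hw⟩, (mem_g _ _).2 ⟨z, hz, hw⟩, hs _ _ hw _ hz' _ hw' hy'⟩
    refine ⟨fwd y, ?_⟩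
    rintro ⟨w, hw, rfl⟩
    obtain ⟨y', hy', hw'⟩ := (mem_g _ _).1 hw
    obtain ⟨w'', hw'', h3⟩ := fwd y' hy'
    obtain rfl := Part.mem_unique hw'' hw
    rwa [h3]
  refine ⟨r, g, s, Sandwich.ext_mem fun x y => ?_⟩
  rw [mem_theta]
  by_cases hx : x ∈ a.ran
  · rw [show r.extend x = _ from Retr.extend_of_mem r ⟨x, hx⟩, key ⟨x, hx⟩]
    simp
  · rw [show r.extend x = _ from Retr.extend_of_notMem r ⟨x, hx⟩]
    constructor
    · intro hy
      obtain ⟨z, hz, w, hw, z', hz', w', hw', hy'⟩ := (hmem _ _).1 hy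
      refine ⟨⟨w', z', hw'⟩, (mem_r _ _).2 ⟨z, hz, w, hw, z', hz', hw'⟩, ?_⟩
      exact (key ⟨w', z', hw'⟩ y).1 hy'
    · rintro ⟨w', hw', h⟩
      obtain ⟨z, hz, w, hw, z', hz', hw'⟩ := (mem_r _ _).1 hw'
      exact (hmem _ _).2 ⟨z, hz, w, hw, z', hz', w', hw', (key _ _).2 h⟩

theorem phi_theta {b : X →. Y} (hb : IsSection a b) {r : Retr a} {g : PT a.ran} {s : Sect a}
    (hf : theta r g s ∈ regularElements (Sandwich a)) : phi a b ⟨theta r g s, hf⟩ = g := by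
  have hmem : ∀ (x y : a.ran), y ∈ phi a b ⟨theta r g s, hf⟩ x ↔
      ∃ p ∈ b x, ∃ q ∈ a p, ∃ z ∈ theta r g s q, (y : X) ∈ a z := by
    intro x y
    refine Part.mem_bind_iff.trans ?_
    constructor
    · rintro ⟨w, h, hy⟩
      obtain ⟨_, hy⟩ := Part.mem_assert_iff.1 hy
      obtain rfl := Part.mem_some_iff.1 hy
      obtain ⟨z, h, h1⟩ := Part.mem_bind_iff.1 h
      obtain ⟨q, h, h2⟩ := Part.mem_bind_iff.1 h
      obtain ⟨p, h, h3⟩ := Part.mem_bind_iff.1 h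
      exact ⟨p, h, q, h3, z, h2, h1⟩
    · rintro ⟨p, h, q, h3, z, h2, h1⟩
      exact ⟨y, Part.mem_bind (Part.mem_bind (Part.mem_bind h h3) h2) h1,
        Part.mem_assert y.2 (Part.mem_some _)⟩
  refine PFun.ext fun x y => (hmem x y).trans ?_
  constructor
  · rintro ⟨p, hp, q, hq, z, hz, hy⟩
    obtain rfl := Part.mem_unique hq (hb.2 _ _ hp)
    obtain ⟨w, hw, rfl⟩ := mem_theta_of_mem.1 hz
    obtain rfl : y = w := Subtype.ext (Part.mem_unique hy (s w).2)
    exact hw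
  · intro hy
    obtain ⟨p, hp⟩ : ∃ p, p ∈ b x := (PFun.mem_dom b x).1 (by rw [hb.1]; exact x.2)
    exact ⟨p, hp, x, hb.2 _ _ hp, s y, mem_theta_of_mem.2 ⟨y, hy, rfl⟩, (s y).2⟩

/-- The products of idempotents are the elements whose middle coordinate is a product of
idempotents. -/
theorem mem_idempotentGenerated_iff {f : Sandwich a} :
    f ∈ idempotentGenerated (Sandwich a) ↔
      ∃ r s, ∃ g ∈ idempotentGenerated (PT a.ran), f = theta r g s := by
  constructor
  · intro hf
    induction hf using Subsemigroup.closure_induction with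
    | mem e he =>
      have hreg : e ∈ regularElements (Sandwich a) :=
        ⟨e, by rw [show e * e = e from he, show e * e = e from he]⟩
      obtain ⟨r, g, s, rfl⟩ := mem_regularElements_iff.1 hreg
      exact ⟨r, s, g, Subsemigroup.subset_closure (isIdempotentElem_theta.1 he), rfl⟩
    | mul f f' _ _ hf hf' =>
      obtain ⟨r, s, g, hg, rfl⟩ := hf
      obtain ⟨r', s', g', hg', rfl⟩ := hf'
      exact ⟨r, s', g * g', mul_mem hg hg', theta_mul ..⟩
  · rintro ⟨r, s, g, hg, rfl⟩
    induction hg using Subsemigroup.closure_induction with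
    | mem e he => exact Subsemigroup.subset_closure (isIdempotentElem_theta.2 he)
    | mul g g' _ _ hg hg' =>
      rw [← theta_mul r r g g' s s]
      exact mul_mem hg hg'

theorem theta_mem_idempotentGenerated {r : Retr a} {g : PT a.ran} {s : Sect a} :
    theta r g s ∈ idempotentGenerated (Sandwich a) ↔ g ∈ idempotentGenerated (PT a.ran) := by
  rw [mem_idempotentGenerated_iff]
  constructor
  · rintro ⟨r', s', g', hg', h⟩
    rwa [theta_middle_inj h]
  · exact fun h => ⟨r, s, g, h, rfl⟩

theorem idempotentGenerated_eq_preimage {b : X →. Y} (hb : IsSection a b) :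
    (idempotentGenerated (Sandwich a) : Set (Sandwich a)) =
      Subtype.val '' (phi a b ⁻¹' (idempotentGenerated (PT a.ran) : Set (PT a.ran))) := by
  ext f
  constructor
  · intro hf
    obtain ⟨r, s, g, hg, rfl⟩ := mem_idempotentGenerated_iff.1 hf
    refine ⟨⟨_, theta_mem_regularElements r g s⟩, ?_, rfl⟩
    change phi a b _ ∈ idempotentGenerated (PT a.ran)
    rwa [phi_theta hb]
  · rintro ⟨⟨f, hf⟩, h, rfl⟩
    obtain ⟨r, g, s, rfl⟩ := mem_regularElements_iff.1 hf
    change phi a b _ ∈ idempotentGenerated (PT a.ran) at h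
    rw [phi_theta hb] at h
    exact theta_mem_idempotentGenerated.2 h

end Coordinates

/-! ### Idempotents of defect one and generation of the idempotents -/

section Singles

variable {A : Type u}

open Classical in
/-- The partial transformation that moves `u` to `v` (or leaves it without image, if `v` is
`Part.none`) and fixes all other points. -/
noncomputable def PT.single (u : A) (v : Part A) : PT A :=
  fun x => if x = u then v else Part.some x

open Classical in
theorem PT.ap_single (u : A) (v p : Part A) :
    (PT.single u v).ap p = if p = Part.some u then v else p := by
  rcases Part.eq_none_or_eq_some p with rfl | ⟨x, rfl⟩
  · rw [PT.ap_none, if_neg (Part.some_ne_none u).symm]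
  · rw [PT.ap_some]
    simp only [PT.single, Part.some_inj]

theorem PT.isIdempotentElem_single {u : A} {v : Part A} (h : v ≠ Part.some u) :
    IsIdempotentElem (PT.single u v) := by
  refine PT.ext_ap fun p => ?_
  simp only [PT.ap_mul, PT.ap_single]
  grind

theorem PT.single_ne_id {u : A} {v : Part A} (h : v ≠ Part.some u) :
    PT.single u v ≠ PT.id := fun h1 => h <| by
  have h2 := PT.ap_single u v (Part.some u)
  rw [h1, PT.ap_id, if_pos rfl] at h2
  exact h2.symm

/-- Going twice around a 3-cycle of `PT.single`s reverses one of its arrows. -/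
theorem PT.single_triangle {x y z : A} (hxy : x ≠ y) (hyz : y ≠ z) (hzx : z ≠ x) :
    PT.single x (Part.some y) * PT.single z (Part.some x) * PT.single y (Part.some z) *
      (PT.single x (Part.some y) * PT.single z (Part.some x) * PT.single y (Part.some z)) =
      PT.single y (Part.some x) := by
  refine PT.ext_ap fun p => ?_
  simp only [PT.ap_mul, PT.ap_single]
  have := Part.some_inj (a := x) (b := y)
  have := Part.some_inj (a := y) (b := z)
  have := Part.some_inj (a := z) (b := x)
  grind

/-- An idempotent of the partial transformation semigroup of a finite set moves its non-fixed
points one at a time. -/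
theorem PT.mem_of_isIdempotentElem [Finite A] {C : Subsemigroup (PT A)}
    (hC : ∀ u v, v ≠ Part.some u → PT.single u v ∈ C) {e : PT A} (he : IsIdempotentElem e)
    (hne : e ≠ PT.id) : e ∈ C := by
  classical
  induction hn : {x | e.ap (Part.some x) ≠ Part.some x}.ncard generalizing e with
  | zero =>
    refine absurd (PT.ext_ap fun p => ?_) hne
    rw [Set.ncard_eq_zero, Set.eq_empty_iff_forall_notMem] at hn
    rw [PT.ap_id]
    rcases Part.eq_none_or_eq_some p with rfl | ⟨x, rfl⟩
    · exact PT.ap_none e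
    · exact not_not.1 (hn x)
  | succ n ih =>
    obtain ⟨x, hx⟩ : {x | e.ap (Part.some x) ≠ Part.some x}.Nonempty := by
      rw [← Set.ncard_pos, hn]
      exact n.succ_pos
    have hee : ∀ p, e.ap (e.ap p) = e.ap p := fun p => by
      rw [← PT.ap_mul, show e * e = e from he]
    have him : ∀ p, e.ap p ≠ Part.some x := fun p hp => hx (by rw [← hp, hee])
    -- `d` agrees with `e` except that it fixes `x`.
    let d : PT A := fun w => if w = x then Part.some x else e w
    have hd : ∀ p, d.ap p = if p = Part.some x then Part.some x else e.ap p := by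
      intro p
      rcases Part.eq_none_or_eq_some p with rfl | ⟨w, rfl⟩
      · rw [PT.ap_none, PT.ap_none, if_neg (Part.some_ne_none x).symm]
      · rw [PT.ap_some, PT.ap_some]
        simp only [d, Part.some_inj]
    have hed : e = d * PT.single x (e.ap (Part.some x)) := by
      refine PT.ext_ap fun p => ?_
      rw [PT.ap_mul, PT.ap_single, hd]
      have := him p
      grind
    by_cases hdid : d = PT.id
    · rw [hdid, PT.id_mul] at hed
      rw [hed]
      exact hC _ _ (him _)
    · rw [hed]
      refine mul_mem (ih ?_ hdid ?_) (hC _ _ (him _))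
      · refine PT.ext_ap fun p => ?_
        rw [PT.ap_mul, hd, hd]
        have := him p
        have := hee p
        grind
      · have : {w | d.ap (Part.some w) ≠ Part.some w} =
            {w | e.ap (Part.some w) ≠ Part.some w} \ {x} := by
          ext w
          have := Part.some_inj (a := w) (b := x)
          simp only [Set.mem_ofPred_eq, Set.mem_sdiff, Set.mem_singleton_iff, hd]
          grind
        rw [this, Set.ncard_sdiff_singleton_of_mem hx, hn]
        rfl

/-- Each pair of distinct points of `Part A` is the only pair identified by some idempotent. -/
theorem exists_isIdempotentElem_of_not_isDiag {κ : Sym2 (Part A)} (hκ : ¬ κ.IsDiag) :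
    ∃ e : PT A, IsIdempotentElem e ∧ e ≠ PT.id ∧
      ∀ p q, p ≠ q → e.ap p = e.ap q → s(p, q) = κ := by
  classical
  have key : ∀ (u : A) (v : Part A), v ≠ Part.some u → ∀ p q, p ≠ q →
      (PT.single u v).ap p = (PT.single u v).ap q → s(p, q) = s(Part.some u, v) := by
    intro u v _ p q hpq h
    simp only [PT.ap_single] at h
    rw [Sym2.eq_iff]
    grind
  induction κ using Sym2.ind with | _ p q => ?_
  rw [Sym2.mk_isDiag_iff] at hκ
  rcases Part.eq_none_or_eq_some p with rfl | ⟨x, rfl⟩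
  · rcases Part.eq_none_or_eq_some q with rfl | ⟨y, rfl⟩
    · exact absurd rfl hκ
    · rw [Sym2.eq_swap]
      exact ⟨_, PT.isIdempotentElem_single hκ, PT.single_ne_id hκ, key _ _ hκ⟩
  · exact ⟨_, PT.isIdempotentElem_single (Ne.symm hκ), PT.single_ne_id (Ne.symm hκ),
      key _ _ (Ne.symm hκ)⟩

theorem mk_not_isDiag {n : ℕ} (hA : #A = n) :
    #{κ : Sym2 (Part A) // ¬ κ.IsDiag} = ((n + 1).choose 2 : ℕ) := by
  classical
  have : Finite A := Cardinal.mk_lt_aleph0_iff.1 (hA ▸ Cardinal.natCast_lt_aleph0)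
  have := Fintype.ofFinite A
  have : Fintype (Part A) := Fintype.ofEquiv _ (Part.equivOption (α := A)).symm
  have h1 : Fintype.card A = n := by rwa [Cardinal.mk_fintype, Nat.cast_inj] at hA
  rw [Cardinal.mk_fintype, Sym2.card_subtype_not_diag, Fintype.card_congr Part.equivOption,
    Fintype.card_option, h1]

/-- On a set of at least three points listed as `0, 1, …`, the tournament with the arrows
`i → i + 1`, and `j → i` for `i + 1 < j`, generates all arrows, since each reversed arrow closes a
3-cycle of arrows that are already available. -/
theorem PT.single_mem_of_tournament {n : ℕ} (hn : 3 ≤ n) (idx : A ≃ Fin n)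
    {C : Subsemigroup (PT A)}
    (hC : ∀ x y, (idx y : ℕ) = idx x + 1 ∨ (idx y : ℕ) + 1 < idx x →
      PT.single x (Part.some y) ∈ C) {x y : A} (hxy : x ≠ y) :
    PT.single x (Part.some y) ∈ C := by
  have tri : ∀ x y z : A, (idx x : ℕ) ≠ idx y → (idx y : ℕ) ≠ idx z → (idx z : ℕ) ≠ idx x →
      PT.single x (Part.some y) ∈ C → PT.single y (Part.some z) ∈ C →
      PT.single z (Part.some x) ∈ C → PT.single y (Part.some x) ∈ C := by
    intro x y z hxy hyz hzx h1 h2 h3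
    rw [← PT.single_triangle (x := x) (y := y) (z := z) (by grind) (by grind) (by grind)]
    exact mul_mem (mul_mem (mul_mem h1 h3) h2) (mul_mem (mul_mem h1 h3) h2)
  have pt : ∀ i, i < n → ∃ x, (idx x : ℕ) = i := fun i hi => ⟨idx.symm ⟨i, hi⟩, by simp⟩
  have long : ∀ (d : ℕ) (x y : A), (idx y : ℕ) = idx x + 2 + d →
      PT.single x (Part.some y) ∈ C := by
    intro d
    induction d with
    | zero =>
      intro x y h
      obtain ⟨w, hw⟩ := pt (idx x + 1) (by have := (idx y).2; omega)
      exact tri y x w (by omega) (by omega) (by omega) (hC _ _ (by omega)) (hC _ _ (by omega))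
        (hC _ _ (by omega))
    | succ d ih =>
      intro x y h
      obtain ⟨w, hw⟩ := pt (idx x + 1) (by have := (idx y).2; omega)
      exact tri y x w (by omega) (by omega) (by omega) (hC _ _ (by omega)) (hC _ _ (by omega))
        (ih _ _ (by omega))
  have hne : (idx x : ℕ) ≠ idx y := fun h => hxy (idx.injective (Fin.ext h))
  rcases lt_or_gt_of_ne hne with h | h
  · by_cases h1 : (idx y : ℕ) = idx x + 1
    · exact hC _ _ (Or.inl h1)
    · exact long (idx y - idx x - 2) _ _ (by omega)
  · by_cases h1 : (idx x : ℕ) = idx y + 1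
    · by_cases h2 : (idx x : ℕ) + 1 < n
      · obtain ⟨z, hz⟩ := pt _ h2
        exact tri y x z (by omega) (by omega) (by omega) (hC _ _ (by omega))
          (hC _ _ (by omega)) (hC _ _ (by omega))
      · obtain ⟨z, hz⟩ := pt (idx y - 1) (by have := (idx y).2; omega)
        exact tri y x z (by omega) (by omega) (by omega) (hC _ _ (by omega))
          (hC _ _ (by omega)) (hC _ _ (by omega))
    · exact hC _ _ (by omega)

theorem PT.exists_idempotent_generators [Finite A] {n : ℕ} (hA : #A = n) (hn : n ≠ 2) :
    ∃ G : Set (PT A), #G ≤ ((n + 1).choose 2 : ℕ) ∧ (∀ e ∈ G, IsIdempotentElem e) ∧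
      ∀ e : PT A, IsIdempotentElem e → e ≠ PT.id → e ∈ Subsemigroup.closure G := by
  obtain ⟨idx⟩ : Nonempty (A ≃ Fin n) :=
    ⟨Finite.equivFinOfCardEq (by rw [Nat.card, hA, Cardinal.toNat_natCast])⟩
  -- All arrows into `Part.none`, and one orientation of each pair of points.
  let D (u : A) (v : Part A) : Prop := v = Part.none ∨
    ∃ w, v = Part.some w ∧ ((idx w : ℕ) = idx u + 1 ∨ (idx w : ℕ) + 1 < idx u)
  have hDne : ∀ u v, D u v → v ≠ Part.some u := by
    rintro u v (rfl | ⟨w, rfl, h⟩) h1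
    · exact Part.some_ne_none u h1.symm
    · rw [Part.some_inj.1 h1] at h
      omega
  have hDas : ∀ u w, D u (Part.some w) → ¬ D w (Part.some u) := by
    rintro u w (h | ⟨x, h, h1⟩) (h' | ⟨x', h', h1'⟩)
    · exact Part.some_ne_none _ h
    · exact Part.some_ne_none _ h
    · exact Part.some_ne_none _ h'
    · rw [← Part.some_inj.1 h] at h1
      rw [← Part.some_inj.1 h'] at h1'
      omega
  let G : Set (PT A) := {g | ∃ u v, D u v ∧ g = PT.single u v}
  have hDC : ∀ u v, D u v → PT.single u v ∈ Subsemigroup.closure G := fun u v h =>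
    Subsemigroup.subset_closure ⟨u, v, h, rfl⟩
  refine ⟨G, ?_, ?_, fun e he hne => PT.mem_of_isIdempotentElem (fun u v huv => ?_) he hne⟩
  · rw [← mk_not_isDiag hA]
    choose U V hD hUV using fun g : G => g.2
    refine Cardinal.mk_le_of_injective
      (f := fun g : G => (⟨s(Part.some (U g), V g), ?_⟩ : {κ : Sym2 (Part A) // ¬ κ.IsDiag})) ?_
    · rw [Sym2.mk_isDiag_iff]
      exact (hDne _ _ (hD g)).symm
    · intro g h hgh
      have h1 : s(Part.some (U g), V g) = s(Part.some (U h), V h) := congrArg Subtype.val hgh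
      refine Subtype.ext ?_
      rw [hUV g, hUV h]
      rcases Sym2.eq_iff.1 h1 with ⟨h2, h3⟩ | ⟨h2, h3⟩
      · rw [Part.some_inj.1 h2, h3]
      · have hg := hD g
        have hh := hD h
        rw [h3] at hg
        rw [← h2] at hh
        exact absurd hh (hDas _ _ hg)
  · rintro _ ⟨u, v, h, rfl⟩
    exact PT.isIdempotentElem_single (hDne _ _ h)
  · rcases Part.eq_none_or_eq_some v with rfl | ⟨w, rfl⟩
    · exact hDC _ _ (Or.inl rfl)
    · have huw : u ≠ w := fun h => huv (by rw [h])
      refine PT.single_mem_of_tournament ?_ idx (fun x y h => hDC _ _ (Or.inr ⟨y, rfl, h⟩)) huw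
      have h1 : (idx u : ℕ) ≠ idx w := fun h => huw (idx.injective (Fin.ext h))
      have := (idx u).2
      have := (idx w).2
      omega

/-- On two points, three non-idempotent generators do what would take four idempotents. -/
theorem PT.exists_generators_of_mk_eq_two (hA : #A = 2) :
    ∃ G : Set (PT A), #G ≤ 3 ∧ G ⊆ idempotentGenerated (PT A) ∧
      ∀ e : PT A, IsIdempotentElem e → e ≠ PT.id → e ∈ Subsemigroup.closure G := by
  classical
  obtain ⟨x, y, hxy, huniv⟩ := Cardinal.mk_eq_two_iff.1 hA
  have hxy' : ∀ z, z = x ∨ z = y := fun z => by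
    have : z ∈ ({x, y} : Set A) := huniv ▸ Set.mem_univ z
    simpa using this
  have : Finite A := Cardinal.mk_lt_aleph0_iff.1 (hA ▸ Cardinal.natCast_lt_aleph0 (n := 2))
  have hsxy : Part.some x ≠ Part.some y := fun h => hxy (Part.some_inj.1 h)
  have hsx : Part.some x ≠ Part.none := Part.some_ne_none x
  have hsy : Part.some y ≠ Part.none := Part.some_ne_none y
  let f : PT A := PT.single y Part.none * PT.single x (Part.some y)
  let g : PT A := PT.single x Part.none * PT.single y (Part.some x)
  let c : PT A := PT.single y (Part.some x)
  have hidem : ∀ u v, v ≠ Part.some u → PT.single u v ∈ idempotentGenerated (PT A) :=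
    fun u v h => Subsemigroup.subset_closure (PT.isIdempotentElem_single h)
  refine ⟨{f, g, c}, ?_, ?_, fun e he hne => PT.mem_of_isIdempotentElem (fun u v huv => ?_) he hne⟩
  · exact (Cardinal.mk_insert_le.trans (add_le_add_left
      (Cardinal.mk_insert_le.trans_eq (by rw [Cardinal.mk_singleton])) 1)).trans_eq (by norm_num)
  · rintro _ (rfl | rfl | rfl)
    · exact mul_mem (hidem _ _ hsy.symm) (hidem _ _ hsxy.symm)
    · exact mul_mem (hidem _ _ hsx.symm) (hidem _ _ hsxy)
    · exact hidem _ _ hsxy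
  · have hf : f ∈ Subsemigroup.closure {f, g, c} := Subsemigroup.subset_closure (by simp)
    have hg : g ∈ Subsemigroup.closure {f, g, c} := Subsemigroup.subset_closure (by simp)
    have hc : c ∈ Subsemigroup.closure {f, g, c} := Subsemigroup.subset_closure (by simp)
    have hfp : ∀ p, f.ap p = if p = Part.some x then Part.some y else
        if p = Part.some y then Part.none else p := by
      intro p
      simp only [f, PT.ap_mul, PT.ap_single]
      grind
    have hgp : ∀ p, g.ap p = if p = Part.some y then Part.some x else
        if p = Part.some x then Part.none else p := by
      intro p
      simp only [g, PT.ap_mul, PT.ap_single]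
      grind
    rcases Part.eq_none_or_eq_some v with rfl | ⟨w, rfl⟩
    · rcases hxy' u with rfl | rfl
      · rw [show PT.single u Part.none = g * f from PT.ext_ap fun p => by
          rw [PT.ap_mul, hgp, hfp, PT.ap_single]
          grind]
        exact mul_mem hg hf
      · rw [show PT.single u Part.none = f * g from PT.ext_ap fun p => by
          rw [PT.ap_mul, hgp, hfp, PT.ap_single]
          grind]
        exact mul_mem hf hg
    · have huw : u ≠ w := fun h => huv (by rw [h])
      rcases hxy' u with rfl | rfl <;> rcases hxy' w with rfl | rfl
      · exact absurd rfl huw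
      · rw [show PT.single u (Part.some w) = c * f from PT.ext_ap fun p => by
          rw [PT.ap_mul, hfp, PT.ap_single, PT.ap_single]
          grind]
        exact mul_mem hc hf
      · exact hc
      · exact absurd rfl huw

/-- Over a set of `n` points, `(n + 1).choose 2` elements suffice to generate all idempotents other
than the identity. -/
theorem PT.exists_generators [Finite A] {n : ℕ} (hA : #A = n) :
    ∃ G : Set (PT A), #G ≤ ((n + 1).choose 2 : ℕ) ∧ G ⊆ idempotentGenerated (PT A) ∧
      (n ≠ 2 → ∀ e ∈ G, IsIdempotentElem e) ∧
      ∀ e : PT A, IsIdempotentElem e → e ≠ PT.id → e ∈ Subsemigroup.closure G := by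
  by_cases hn : n = 2
  · subst hn
    obtain ⟨G, h1, h2, h3⟩ := PT.exists_generators_of_mk_eq_two (by exact_mod_cast hA)
    exact ⟨G, h1, h2, fun h => absurd rfl h, h3⟩
  · obtain ⟨G, h1, h2, h3⟩ := PT.exists_idempotent_generators hA hn
    exact ⟨G, h1, fun e he => Subsemigroup.subset_closure (h2 e he), fun _ => h2, h3⟩

end Singles

/-! ### Generating sets of the idempotent-generated subsemigroup -/

section GeneratingSets

theorem lift_mk_le_of_injective {α : Type u} {β : Type max u v} {f : α → β}
    (hf : Function.Injective f) : lift.{v} #α ≤ #β := by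
  rw [← Cardinal.mk_uLift]
  exact Cardinal.mk_le_of_injective (f := f ∘ ULift.down) (hf.comp ULift.down_injective)

theorem semigroupRank_le {S : Type u} [Semigroup S] {G : Set S}
    (hG : Subsemigroup.closure G = ⊤) : semigroupRank S ≤ #G :=
  csInf_le' ⟨G, hG, rfl⟩

theorem le_semigroupRank {S : Type u} [Semigroup S] {c : Cardinal.{u}}
    (h : ∀ G : Set S, Subsemigroup.closure G = ⊤ → c ≤ #G) : c ≤ semigroupRank S := by
  refine le_csInf ⟨_, Set.univ, Subsemigroup.closure_univ, rfl⟩ ?_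
  rintro _ ⟨G, hG, rfl⟩
  exact h G hG

theorem idempotentRank_le {S : Type u} [Semigroup S] {G : Set S}
    (hi : ∀ e ∈ G, IsIdempotentElem e) (hG : Subsemigroup.closure G = ⊤) :
    idempotentRank S ≤ #G :=
  csInf_le' ⟨G, hi, hG, rfl⟩

/-- A lower bound for the sizes of all generating sets bounds the idempotent rank, provided that
there is a generating set of idempotents at all; otherwise the infimum is over the empty set. -/
theorem le_idempotentRank {S : Type u} [Semigroup S] {c : Cardinal.{u}}
    (hS : ∃ G : Set S, (∀ e ∈ G, IsIdempotentElem e) ∧ Subsemigroup.closure G = ⊤)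
    (h : ∀ G : Set S, Subsemigroup.closure G = ⊤ → c ≤ #G) : c ≤ idempotentRank S := by
  obtain ⟨G, hi, hG⟩ := hS
  refine le_csInf ⟨_, G, hi, hG, rfl⟩ ?_
  rintro _ ⟨G, -, hG, rfl⟩
  exact h G hG

variable {X : Type u} {Y : Type v} {a : Y →. X}

/-- A product of `theta`s over the identity has all its factors over the identity, and its
retraction is that of the first factor. -/
theorem exists_mem_theta_retr {G : Set (idempotentGenerated (Sandwich a))}
    (hG : Subsemigroup.closure G = ⊤) (r : Retr a) :
    ∃ h ∈ G, ∃ s, (h : Sandwich a) = theta r PT.id s := by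
  obtain ⟨s₀⟩ := Sect.nonempty a
  have key : ∀ f ∈ Subsemigroup.closure G, ∀ s, (f : Sandwich a) = theta r PT.id s →
      ∃ h ∈ G, ∃ s, (h : Sandwich a) = theta r PT.id s := by
    intro f hf
    induction hf using Subsemigroup.closure_induction with
    | mem f hf => exact fun s hs => ⟨f, hf, s, hs⟩
    | mul f f' _ _ hf _ =>
      intro s hs
      obtain ⟨r₁, s₁, g₁, hg₁, h₁⟩ := mem_idempotentGenerated_iff.1 f.2
      obtain ⟨r₂, s₂, g₂, hg₂, h₂⟩ := mem_idempotentGenerated_iff.1 f'.2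
      rw [MulMemClass.coe_mul, h₁, h₂, theta_mul] at hs
      obtain ⟨rfl, rfl⟩ := PT.eq_id_of_mul_eq_id hg₁ (theta_middle_inj hs)
      rw [PT.id_mul] at hs
      obtain ⟨rfl, -⟩ := theta_id_inj hs
      exact hf _ h₁
  exact key ⟨theta r PT.id s₀, theta_mem_idempotentGenerated.2
    (Subsemigroup.subset_closure PT.isIdempotentElem_id)⟩ (hG ▸ Subsemigroup.mem_top _) s₀ rfl

theorem exists_mem_theta_sect {G : Set (idempotentGenerated (Sandwich a))}
    (hG : Subsemigroup.closure G = ⊤) (s : Sect a) :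
    ∃ h ∈ G, ∃ r, (h : Sandwich a) = theta r PT.id s := by
  have key : ∀ f ∈ Subsemigroup.closure G, ∀ r, (f : Sandwich a) = theta r PT.id s →
      ∃ h ∈ G, ∃ r, (h : Sandwich a) = theta r PT.id s := by
    intro f hf
    induction hf using Subsemigroup.closure_induction with
    | mem f hf => exact fun r hr => ⟨f, hf, r, hr⟩
    | mul f f' _ _ _ hf' =>
      intro r hr
      obtain ⟨r₁, s₁, g₁, hg₁, h₁⟩ := mem_idempotentGenerated_iff.1 f.2
      obtain ⟨r₂, s₂, g₂, hg₂, h₂⟩ := mem_idempotentGenerated_iff.1 f'.2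
      rw [MulMemClass.coe_mul, h₁, h₂, theta_mul] at hr
      obtain ⟨rfl, rfl⟩ := PT.eq_id_of_mul_eq_id hg₁ (theta_middle_inj hr)
      rw [PT.id_mul] at hr
      obtain ⟨-, rfl⟩ := theta_id_inj hr
      exact hf' _ h₂
  exact key ⟨theta (fun _ => Part.none) PT.id s, theta_mem_idempotentGenerated.2
    (Subsemigroup.subset_closure PT.isIdempotentElem_id)⟩ (hG ▸ Subsemigroup.mem_top _) _ rfl

theorem max_le_mk_theta_id {G : Set (idempotentGenerated (Sandwich a))}
    (hG : Subsemigroup.closure G = ⊤) :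
    max (lift.{v} #(Retr a)) #(Sect a) ≤
      #{h | h ∈ G ∧ ∃ r s, (h : Sandwich a) = theta r PT.id s} := by
  refine max_le ?_ ?_
  · choose h hG s hs using exists_mem_theta_retr hG
    refine lift_mk_le_of_injective
      (f := fun r => (⟨h r, hG r, r, s r, hs r⟩ :
        {h | h ∈ G ∧ ∃ r s, (h : Sandwich a) = theta r PT.id s})) fun r r' hr => ?_
    have h1 : h r = h r' := congrArg Subtype.val hr
    exact (theta_id_inj ((hs r).symm.trans ((congrArg Subtype.val h1).trans (hs r')))).1
  · choose h hG r hr using exists_mem_theta_sect hG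
    refine Cardinal.mk_le_of_injective
      (f := fun s => (⟨h s, hG s, r s, s, hr s⟩ :
        {h | h ∈ G ∧ ∃ r s, (h : Sandwich a) = theta r PT.id s})) fun s s' hs => ?_
    have h1 : h s = h s' := congrArg Subtype.val hs
    exact (theta_id_inj ((hr s).symm.trans ((congrArg Subtype.val h1).trans (hr s')))).2

/-- The first factor of a product that does not lie over the identity has a kernel contained in
that of the product. -/
theorem exists_mem_ker_le {G : Set (idempotentGenerated (Sandwich a))}
    (hG : Subsemigroup.closure G = ⊤) {e : PT a.ran} (he : e ∈ idempotentGenerated (PT a.ran))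
    (hne : e ≠ PT.id) :
    ∃ h ∈ G, ∃ r g s, g ∈ idempotentGenerated (PT a.ran) ∧ g ≠ PT.id ∧
      (h : Sandwich a) = theta r g s ∧ ∀ p q, g.ap p = g.ap q → e.ap p = e.ap q := by
  obtain ⟨s₀⟩ := Sect.nonempty a
  have key : ∀ f ∈ Subsemigroup.closure G, ∀ r e s, e ≠ PT.id → (f : Sandwich a) = theta r e s →
      ∃ h ∈ G, ∃ r g s, g ∈ idempotentGenerated (PT a.ran) ∧ g ≠ PT.id ∧
      (h : Sandwich a) = theta r g s ∧ ∀ p q, g.ap p = g.ap q → e.ap p = e.ap q := by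
    intro f hf
    induction hf using Subsemigroup.closure_induction with
    | mem f hf =>
      intro r e s hne h
      refine ⟨f, hf, r, e, s, ?_, hne, h, fun _ _ => id⟩
      rw [← theta_mem_idempotentGenerated (r := r) (s := s), ← h]
      exact f.2
    | mul f f' _ _ hf hf' =>
      intro r e s hne h
      obtain ⟨r₁, s₁, g₁, hg₁, h₁⟩ := mem_idempotentGenerated_iff.1 f.2
      obtain ⟨r₂, s₂, g₂, hg₂, h₂⟩ := mem_idempotentGenerated_iff.1 f'.2
      rw [MulMemClass.coe_mul, h₁, h₂, theta_mul] at h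
      obtain rfl := theta_middle_inj h
      by_cases h3 : g₁ = PT.id
      · subst h3
        rw [PT.id_mul] at hne ⊢
        exact hf' _ _ _ hne h₂
      · obtain ⟨h, hG, r', g', s', hg', hne', hh, hker⟩ := hf _ _ _ h3 h₁
        exact ⟨h, hG, r', g', s', hg', hne', hh, fun p q hpq => by
          rw [PT.ap_mul, PT.ap_mul, hker p q hpq]⟩
  exact key ⟨theta (fun _ => Part.none) e s₀, theta_mem_idempotentGenerated.2 he⟩
    (hG ▸ Subsemigroup.mem_top _) _ e s₀ hne rfl

theorem choose_le_mk_not_theta_id {G : Set (idempotentGenerated (Sandwich a))}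
    (hG : Subsemigroup.closure G = ⊤) {n : ℕ} (hA : #a.ran = n) :
    (((n + 1).choose 2 : ℕ) : Cardinal.{max u v}) ≤
      #{h | h ∈ G ∧ ¬ ∃ r s, (h : Sandwich a) = theta r PT.id s} := by
  have key : ∀ κ : {κ : Sym2 (Part a.ran) // ¬ κ.IsDiag}, ∃ h ∈ G, ∃ r g s, g ≠ PT.id ∧
      (h : Sandwich a) = theta r g s ∧
      (∃ p q, p ≠ q ∧ g.ap p = g.ap q) ∧ ∀ p q, p ≠ q → g.ap p = g.ap q → s(p, q) = κ := by
    intro κ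
    obtain ⟨e, he, hne, hκ⟩ := exists_isIdempotentElem_of_not_isDiag κ.2
    obtain ⟨h, hG, r, g, s, hg, hgne, hh, hker⟩ :=
      exists_mem_ker_le hG (Subsemigroup.subset_closure he) hne
    refine ⟨h, hG, r, g, s, hgne, hh, ?_, fun p q hpq hg => hκ p q hpq (hker p q hg)⟩
    by_contra hcon
    refine hgne (PT.eq_id_of_injective hg fun p q hpq => ?_)
    by_contra h1
    exact hcon ⟨p, q, h1, hpq⟩
  choose h hG r g s hne hh hex hall using key
  have hinj : Function.Injective (fun κ => (⟨h κ, hG κ, fun ⟨r', s', h'⟩ =>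
      hne κ (theta_middle_inj ((hh κ).symm.trans h'))⟩ :
        {h | h ∈ G ∧ ¬ ∃ r s, (h : Sandwich a) = theta r PT.id s})) := by
    intro κ κ' hκ
    have h1 : h κ = h κ' := congrArg Subtype.val hκ
    have h2 : g κ = g κ' :=
      theta_middle_inj ((hh κ).symm.trans ((congrArg Subtype.val h1).trans (hh κ')))
    obtain ⟨p, q, hpq, hp⟩ := hex κ
    exact Subtype.ext ((hall κ p q hpq hp).symm.trans (hall κ' p q hpq (h2 ▸ hp)))
  have := lift_mk_le_of_injective.{u, v} hinj
  rwa [mk_not_isDiag hA, Cardinal.lift_natCast] at this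

theorem le_mk_of_closure_eq_top {G : Set (idempotentGenerated (Sandwich a))}
    (hG : Subsemigroup.closure G = ⊤) {n : ℕ} (hA : #a.ran = n) :
    (((n + 1).choose 2 : ℕ) : Cardinal.{max u v}) + max (lift.{v} #(Retr a)) #(Sect a) ≤ #G := by
  have h1 : G = {h | h ∈ G ∧ ¬ ∃ r s, (h : Sandwich a) = theta r PT.id s} ∪
      {h | h ∈ G ∧ ∃ r s, (h : Sandwich a) = theta r PT.id s} := by
    ext h
    simp only [Set.mem_union, Set.mem_ofPred_eq]
    tauto
  conv_rhs => rw [h1]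
  rw [Cardinal.mk_union_of_disjoint (Set.disjoint_left.2 fun h h1 h2 => h1.2 h2.2)]
  exact add_le_add (choose_le_mk_not_theta_id hG hA) (max_le_mk_theta_id hG)

/-- The graph of a surjection from the larger of two sets to the smaller projects onto both. -/
theorem exists_mk_le_max_of_projections_onto (K : Type u) (L : Type max u v) [Nonempty K]
    [Nonempty L] : ∃ Γ : Set (K × L), #Γ ≤ max (lift.{v} #K) #L ∧
      (∀ k, ∃ l, (k, l) ∈ Γ) ∧ ∀ l, ∃ k, (k, l) ∈ Γ := by
  rw [← Cardinal.mk_uLift]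
  rcases le_total #(ULift.{v} K) #L with h | h
  · obtain ⟨i⟩ := h
    refine ⟨Set.range fun l => ((Function.invFun i l).down, l),
      Cardinal.mk_range_le.trans (le_max_right _ _), fun k => ⟨i ⟨k⟩, i ⟨k⟩, Prod.ext ?_ rfl⟩,
      fun l => ⟨_, l, rfl⟩⟩
    exact congrArg ULift.down (Function.leftInverse_invFun i.injective ⟨k⟩)
  · obtain ⟨i⟩ := h
    refine ⟨Set.range fun k : ULift.{v} K => (k.down, Function.invFun i k),
      Cardinal.mk_range_le.trans (le_max_left _ _), fun k => ⟨_, ⟨k⟩, rfl⟩,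
      fun l => ⟨(i l).down, i l, Prod.ext rfl (Function.leftInverse_invFun i.injective l)⟩⟩

theorem exists_generators {n : ℕ} (hA : #a.ran = n) :
    ∃ G : Set (idempotentGenerated (Sandwich a)), Subsemigroup.closure G = ⊤ ∧
      (n ≠ 2 → ∀ e ∈ G, IsIdempotentElem e) ∧
      #G ≤ (((n + 1).choose 2 : ℕ) : Cardinal.{max u v}) +
        max (lift.{v} #(Retr a)) #(Sect a) := by
  have : Finite a.ran := Cardinal.mk_lt_aleph0_iff.1 (hA ▸ Cardinal.natCast_lt_aleph0)
  obtain ⟨s₀⟩ := Sect.nonempty a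
  let r₀ : Retr a := fun _ => Part.none
  have : Nonempty (Retr a) := ⟨r₀⟩
  have : Nonempty (Sect a) := ⟨s₀⟩
  obtain ⟨Γ, hΓ, hΓr, hΓs⟩ := exists_mk_le_max_of_projections_onto (Retr a) (Sect a)
  obtain ⟨H, hH, hHE, hHi, hHgen⟩ := PT.exists_generators hA
  -- A single lift of each generator suffices: multiplying by elements over the identity on either
  -- side changes its outer coordinates at will.
  let G₁ : Set (Sandwich a) := (fun g => theta r₀ g s₀) '' H
  let G₂ : Set (Sandwich a) := (fun t => theta t.1 PT.id t.2) '' Γ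
  have hid : ∀ r s, theta r PT.id s ∈ Subsemigroup.closure (G₁ ∪ G₂) := by
    intro r s
    obtain ⟨s', hs'⟩ := hΓr r
    obtain ⟨r', hr'⟩ := hΓs s
    have h1 : theta r PT.id s' ∈ Subsemigroup.closure (G₁ ∪ G₂) :=
      Subsemigroup.subset_closure (Or.inr ⟨_, hs', rfl⟩)
    have h2 : theta r' PT.id s ∈ Subsemigroup.closure (G₁ ∪ G₂) :=
      Subsemigroup.subset_closure (Or.inr ⟨_, hr', rfl⟩)
    have h3 := mul_mem h1 h2
    rwa [theta_mul, PT.id_mul] at h3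
  have hH' : ∀ e ∈ Subsemigroup.closure H,
      theta r₀ e s₀ ∈ Subsemigroup.closure (G₁ ∪ G₂) := by
    intro e he
    induction he using Subsemigroup.closure_induction with
    | mem e he => exact Subsemigroup.subset_closure (Or.inl ⟨e, he, rfl⟩)
    | mul e e' _ _ he he' =>
      rw [← theta_mul r₀ r₀ e e' s₀ s₀]
      exact mul_mem he he'
  have hcl : idempotentGenerated (Sandwich a) = Subsemigroup.closure (G₁ ∪ G₂) := by
    apply le_antisymm
    · refine Subsemigroup.closure_le.2 fun f hf => ?_
      obtain ⟨r, s, e, -, rfl⟩ := mem_idempotentGenerated_iff.1 (Subsemigroup.subset_closure hf)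
      have he : IsIdempotentElem e := isIdempotentElem_theta.1 hf
      by_cases hne : e = PT.id
      · rw [hne]
        exact hid r s
      · have := mul_mem (mul_mem (hid r s₀) (hH' e (hHgen e he hne))) (hid r₀ s)
        rwa [theta_mul, theta_mul, PT.id_mul, PT.mul_id] at this
    · refine Subsemigroup.closure_le.2 ?_
      rintro _ (⟨e, he, rfl⟩ | ⟨t, ht, rfl⟩)
      · exact theta_mem_idempotentGenerated.2 (hHE he)
      · exact Subsemigroup.subset_closure
          (isIdempotentElem_theta.2 PT.isIdempotentElem_id)
  refine ⟨Subtype.val ⁻¹' (G₁ ∪ G₂), ?_, ?_, ?_⟩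
  · rw [hcl]
    exact Subsemigroup.closure_closure_coe_preimage
  · rintro hn ⟨e, heE⟩ (⟨g, hg, rfl⟩ | ⟨t, ht, rfl⟩)
    · exact Subtype.ext (isIdempotentElem_theta.2 (hHi hn g hg))
    · exact Subtype.ext (isIdempotentElem_theta.2 PT.isIdempotentElem_id)
  · refine (Cardinal.mk_preimage_of_injective _ _ Subtype.val_injective).trans ?_
    refine (Cardinal.mk_union_le _ _).trans (add_le_add ?_ ?_)
    · have h1 : lift.{u} #G₁ ≤ lift.{max u v} #H := Cardinal.mk_image_le_lift
      have h2 := h1.trans (Cardinal.lift_le.2 hH)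
      simpa using h2
    · exact Cardinal.mk_image_le.trans hΓ

theorem semigroupRank_eq {n : ℕ} (hA : #a.ran = n) :
    semigroupRank (idempotentGenerated (Sandwich a)) =
      (((n + 1).choose 2 : ℕ) : Cardinal.{max u v}) + max (lift.{v} #(Retr a)) #(Sect a) := by
  obtain ⟨G, hG, -, hle⟩ := exists_generators hA
  exact le_antisymm ((semigroupRank_le hG).trans hle)
    (le_semigroupRank fun _ hH => le_mk_of_closure_eq_top hH hA)

theorem idempotentRank_eq {n : ℕ} (hA : #a.ran = n) (hn : n ≠ 2) :
    idempotentRank (idempotentGenerated (Sandwich a)) =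
      (((n + 1).choose 2 : ℕ) : Cardinal.{max u v}) + max (lift.{v} #(Retr a)) #(Sect a) := by
  obtain ⟨G, hG, hi, hle⟩ := exists_generators hA
  exact le_antisymm ((idempotentRank_le (hi hn) hG).trans hle)
    (le_idempotentRank ⟨G, hi hn, hG⟩ fun _ hH => le_mk_of_closure_eq_top hH hA)

theorem lift_mk_retr {n : ℕ} (hA : #a.ran = n) :
    lift.{v} #(Retr a) =
      ((n : Cardinal.{max u v}) + 1) ^ lift.{v, u} #(a.ranᶜ : Set X) := by
  have h1 : #(Part a.ran) = (n : Cardinal.{u}) + 1 := by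
    rw [Cardinal.mk_congr Part.equivOption, Cardinal.mk_option, hA]
  have h2 : #(Retr a) = #(Part a.ran) ^ #(a.ranᶜ : Set X) := rfl
  rw [h2, h1, Cardinal.lift_power, Cardinal.lift_add, Cardinal.lift_natCast, Cardinal.lift_one]

theorem mk_sect : #(Sect a) = kernelProd a := Cardinal.mk_pi _

end GeneratingSets

/-! ### Infinite cardinalities -/

section Infinite

/-- A closure is a quotient of a free semigroup. -/
theorem mk_closure_le_max {S : Type u} [Semigroup S] (G : Set S) :
    #(Subsemigroup.closure G) ≤ max ℵ₀ #G := by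
  let F : FreeSemigroup G →ₙ* S := FreeSemigroup.lift Subtype.val
  have h1 : Subsemigroup.closure G ≤ F.srange :=
    Subsemigroup.closure_le.2 fun x hx => ⟨FreeSemigroup.of ⟨x, hx⟩, FreeSemigroup.lift_of _ _⟩
  have h2 : #(Subsemigroup.closure G) ≤ #(FreeSemigroup G) :=
    (Cardinal.mk_le_mk_of_subset (t := Set.range F) h1).trans Cardinal.mk_range_le
  have h3 : #(FreeSemigroup G) ≤ #(G × List G) :=
    Cardinal.mk_le_of_injective (f := fun w => (w.head, w.tail)) fun w w' h =>
      FreeSemigroup.ext (Prod.ext_iff.1 h).1 (Prod.ext_iff.1 h).2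
  refine h2.trans (h3.trans ?_)
  rw [Cardinal.mk_prod, Cardinal.lift_id, Cardinal.lift_id]
  exact (mul_le_mul' (le_max_right _ _) (Cardinal.mk_list_le_max G)).trans_eq
    (Cardinal.mul_eq_self (le_max_left _ _))

variable {X : Type u} {Y : Type v} {a : Y →. X}

theorem mk_regularElements_le :
    #(regularElements (Sandwich a)) ≤
      lift.{v} #(Retr a) * (lift.{v} #(PT a.ran) * #(Sect a)) := by
  rw [← Cardinal.mk_uLift, ← Cardinal.mk_uLift, Cardinal.mul_def, Cardinal.mul_def]
  refine Cardinal.mk_le_of_surjective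
    (f := fun t : ULift.{v} (Retr a) × ULift.{v} (PT a.ran) × Sect a =>
      ⟨theta t.1.down t.2.1.down t.2.2, theta_mem_regularElements _ _ _⟩) fun ⟨f, hf⟩ => ?_
  obtain ⟨r, g, s, rfl⟩ := mem_regularElements_iff.1 hf
  exact ⟨(⟨r⟩, ⟨g⟩, s), rfl⟩

theorem mk_regularElements_le_of_le {c : Cardinal.{max u v}} (hc : ℵ₀ ≤ c)
    (h1 : lift.{v} #(Retr a) ≤ c) (h2 : lift.{v} #(PT a.ran) ≤ c) (h3 : #(Sect a) ≤ c) :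
    #(regularElements (Sandwich a)) ≤ c :=
  mk_regularElements_le.trans <| (mul_le_mul' h1 (mul_le_mul' h2 h3)).trans_eq <| by
    rw [Cardinal.mul_eq_self hc, Cardinal.mul_eq_self hc]

theorem mk_idempotentGenerated_le :
    #(idempotentGenerated (Sandwich a)) ≤ #(regularElements (Sandwich a)) :=
  Cardinal.mk_le_mk_of_subset (s := (idempotentGenerated (Sandwich a) : Set (Sandwich a)))
    fun f hf => by
      obtain ⟨r, s, g, -, rfl⟩ := mem_idempotentGenerated_iff.1 hf
      exact theta_mem_regularElements r g s

theorem finite_ran_of_finite_regularElements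
    (h : #(regularElements (Sandwich a)) < ℵ₀) : Finite a.ran := by
  obtain ⟨s₀⟩ := Sect.nonempty a
  have := Cardinal.mk_lt_aleph0_iff.1 h
  refine Finite.of_injective (β := regularElements (Sandwich a))
    (fun x => ⟨theta (fun _ => Part.none) (fun _ => Part.some x : PT a.ran) s₀,
      theta_mem_regularElements _ _ _⟩) fun x y hxy => ?_
  exact Part.some_inj.1 (congrFun (theta_middle_inj (congrArg Subtype.val hxy)) x)

/-- If `im(a)` is infinite, the partial identities already make the idempotent-generated
subsemigroup as large as the partial transformation semigroup of `im(a)`. -/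
theorem mk_PT_le_of_infinite [Infinite a.ran] :
    lift.{v} #(PT a.ran) ≤ #(idempotentGenerated (Sandwich a)) ∧
      ℵ₀ < #(idempotentGenerated (Sandwich a)) := by
  classical
  obtain ⟨s₀⟩ := Sect.nonempty a
  let pid (C : Set a.ran) : PT a.ran := fun x => if x ∈ C then Part.some x else Part.none
  have hpid : ∀ C, IsIdempotentElem (pid C) := by
    intro C
    refine PT.ext_ap fun p => ?_
    rw [PT.ap_mul]
    rcases Part.eq_none_or_eq_some p with rfl | ⟨x, rfl⟩
    · rw [PT.ap_none, PT.ap_none]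
    · rw [PT.ap_some]
      by_cases hx : x ∈ C
      · rw [show pid C x = Part.some x from if_pos hx, PT.ap_some]
        exact if_pos hx
      · rw [show pid C x = Part.none from if_neg hx, PT.ap_none]
  have hinj : Function.Injective (fun C => (⟨theta (fun _ => Part.none) (pid C) s₀,
      theta_mem_idempotentGenerated.2 (Subsemigroup.subset_closure (hpid C))⟩ :
        idempotentGenerated (Sandwich a))) := by
    intro C D h
    have h1 : pid C = pid D := theta_middle_inj (congrArg Subtype.val h)
    ext x
    have h2 : pid C x = pid D x := by rw [h1]
    by_cases hC : x ∈ C <;> by_cases hD : x ∈ D <;> simp_all [pid]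
  have hinf : ℵ₀ ≤ #a.ran := Cardinal.aleph0_le_mk _
  have hPT : #(PT a.ran) = #(Set a.ran) := by
    have h2 : #(PT a.ran) = #(Part a.ran) ^ #a.ran := rfl
    rw [h2, Cardinal.mk_congr Part.equivOption, Cardinal.mk_option,
      Cardinal.add_one_eq hinf, Cardinal.power_self_eq hinf, Cardinal.mk_set]
  have h3 : lift.{v} #(Set a.ran) ≤ #(idempotentGenerated (Sandwich a)) :=
    lift_mk_le_of_injective hinj
  refine ⟨hPT ▸ h3, lt_of_lt_of_le ?_ h3⟩
  rw [Cardinal.aleph0_lt_lift, Cardinal.mk_set]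
  exact hinf.trans_lt (Cardinal.cantor _)

theorem mk_regularElements_le_of_closure_eq_top
    (hP : ℵ₀ ≤ #(regularElements (Sandwich a))) {G : Set (idempotentGenerated (Sandwich a))}
    (hG : Subsemigroup.closure G = ⊤) : #(regularElements (Sandwich a)) ≤ #G := by
  have hmax : max (lift.{v} #(Retr a)) #(Sect a) ≤ #G :=
    (max_le_mk_theta_id hG).trans (Cardinal.mk_le_mk_of_subset fun _ h => h.1)
  rcases finite_or_infinite a.ran with hfin | hinf
  · have hPT : #(PT a.ran) < ℵ₀ := by
      have h1 : Finite (Part a.ran) := Finite.of_equiv _ (Part.equivOption (α := a.ran)).symm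
      exact Cardinal.mk_lt_aleph0_iff.2 (inferInstanceAs (Finite (a.ran → Part a.ran)))
    have hG' : ℵ₀ ≤ #G := by
      by_contra! hlt
      have hm := hmax.trans_lt hlt
      exact absurd (hP.trans mk_regularElements_le) (not_le.2 <|
        Cardinal.mul_lt_aleph0 ((le_max_left _ _).trans_lt hm) <|
          Cardinal.mul_lt_aleph0 (Cardinal.lift_lt_aleph0.2 hPT) ((le_max_right _ _).trans_lt hm))
    exact mk_regularElements_le_of_le hG' ((le_max_left _ _).trans hmax)
      ((Cardinal.lift_lt_aleph0.2 hPT).le.trans hG') ((le_max_right _ _).trans hmax)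
  · obtain ⟨h1, h2⟩ := mk_PT_le_of_infinite (a := a)
    have hG' : #(idempotentGenerated (Sandwich a)) ≤ #G := by
      have h3 := mk_closure_le_max G
      rw [hG] at h3
      have h4 : #(idempotentGenerated (Sandwich a)) ≤ max ℵ₀ #G :=
        (Cardinal.mk_congr Subsemigroup.topEquiv.toEquiv).symm.trans_le h3
      exact (le_max_iff.1 h4).resolve_left (not_le.2 h2)
    exact mk_regularElements_le_of_le (h2.le.trans hG') ((le_max_left _ _).trans hmax)
      (h1.trans hG') ((le_max_right _ _).trans hmax)

theorem ranks_eq_of_infinite (hP : ℵ₀ ≤ #(regularElements (Sandwich a))) :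
    semigroupRank (idempotentGenerated (Sandwich a)) = #(idempotentGenerated (Sandwich a)) ∧
      idempotentRank (idempotentGenerated (Sandwich a)) =
        #(idempotentGenerated (Sandwich a)) ∧
      #(idempotentGenerated (Sandwich a)) = #(regularElements (Sandwich a)) := by
  have hlow {G : Set (idempotentGenerated (Sandwich a))} (hG : Subsemigroup.closure G = ⊤) :
      #(idempotentGenerated (Sandwich a)) ≤ #G :=
    mk_idempotentGenerated_le.trans (mk_regularElements_le_of_closure_eq_top hP hG)
  have htop : Subsemigroup.closure (Set.univ : Set (idempotentGenerated (Sandwich a))) = ⊤ :=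
    Subsemigroup.closure_univ
  have hidem : ∃ G : Set (idempotentGenerated (Sandwich a)),
      (∀ e ∈ G, IsIdempotentElem e) ∧ Subsemigroup.closure G = ⊤ :=
    ⟨Subtype.val ⁻¹' {e : Sandwich a | IsIdempotentElem e}, fun e he => Subtype.ext he,
      Subsemigroup.closure_closure_coe_preimage⟩
  refine ⟨le_antisymm ((semigroupRank_le htop).trans_eq Cardinal.mk_univ)
    (le_semigroupRank fun _ => hlow), le_antisymm ?_ (le_idempotentRank hidem fun _ => hlow),
    le_antisymm mk_idempotentGenerated_le ?_⟩
  · obtain ⟨G, hGi, hG⟩ := hidem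
    exact (idempotentRank_le hGi hG).trans (Cardinal.mk_set_le G)
  · exact (mk_regularElements_le_of_closure_eq_top hP htop).trans_eq Cardinal.mk_univ

end Infinite

end SandwichPT

theorem mainTheorem2 {X : Type u} {Y : Type v} (a : Y →. X) (b : X →. Y)
    (hb : SandwichPT.IsSection a b) :
    (SandwichPT.idempotentGenerated (SandwichPT.Sandwich a) : Set (SandwichPT.Sandwich a)) =
        Subtype.val '' (SandwichPT.phi a b ⁻¹'
          (SandwichPT.idempotentGenerated (SandwichPT.PT a.ran) : Set (SandwichPT.PT a.ran))) ∧
    (ℵ₀ ≤ #(SandwichPT.regularElements (SandwichPT.Sandwich a)) →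
      SandwichPT.semigroupRank (SandwichPT.idempotentGenerated (SandwichPT.Sandwich a)) =
          #(SandwichPT.idempotentGenerated (SandwichPT.Sandwich a)) ∧
      SandwichPT.idempotentRank (SandwichPT.idempotentGenerated (SandwichPT.Sandwich a)) =
          #(SandwichPT.idempotentGenerated (SandwichPT.Sandwich a)) ∧
      #(SandwichPT.idempotentGenerated (SandwichPT.Sandwich a)) =
          #(SandwichPT.regularElements (SandwichPT.Sandwich a))) ∧
    (#(SandwichPT.regularElements (SandwichPT.Sandwich a)) < ℵ₀ →
      ∃ n : ℕ, #a.ran = n ∧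
        SandwichPT.semigroupRank (SandwichPT.idempotentGenerated (SandwichPT.Sandwich a)) =
          ((n + 1).choose 2 : Cardinal.{max u v}) +
            max (((n : Cardinal.{max u v}) + 1) ^ Cardinal.lift.{v, u} #(a.ranᶜ : Set X))
              (SandwichPT.kernelProd a) ∧
        (n ≠ 2 →
          SandwichPT.idempotentRank (SandwichPT.idempotentGenerated (SandwichPT.Sandwich a)) =
            SandwichPT.semigroupRank
              (SandwichPT.idempotentGenerated (SandwichPT.Sandwich a)))) := by
  refine ⟨SandwichPT.idempotentGenerated_eq_preimage hb, SandwichPT.ranks_eq_of_infinite,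
    fun hP => ?_⟩
  have := SandwichPT.finite_ran_of_finite_regularElements hP
  obtain ⟨n, hn⟩ := Cardinal.lt_aleph0.1 (Cardinal.mk_lt_aleph0_iff.2 this)
  refine ⟨n, hn, ?_, fun hn2 => ?_⟩
  · rw [SandwichPT.semigroupRank_eq hn, SandwichPT.lift_mk_retr hn, SandwichPT.mk_sect]
  · rw [SandwichPT.idempotentRank_eq hn hn2, SandwichPT.semigroupRank_eq hn]
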